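/- **Setting.** Fix a period $\ell>0$, a core radius $r_0\in(0,\ell/2)$, Lamé coefficients $\mu,\lambda\in\mathbb R$ with $\mu>0$ and $\mu+\lambda>0$, a surface tension $\gamma>0$, a mismatch $e_0\neq 0$, Burgers vectors $\mathbf b_1,\dots,\mathbf b_k\in\mathbb R^2$ ($k\ge 0$), and a nonnegative radially symmetric $\varrho\in C_c^\infty(B_1(0))$ with $\int_{\mathbb R^2}\varrho\,dz=1$; put $\varrho_{r_0}(z):=r_0^{-2}\varrho(z/r_0)$. *Profiles.* $AP(0,\ell)$ is the set of lower semicontinuous $\ell$-periodic functions $h:\mathbb R\to[0,\infty)$ with finite pointwise total variation on $(0,\ell)$. Let $h^+(x)$ and $h^-(x)$ be the maximum and the minimum of the one-sided limits $h(x+)$, $h(x-)$, and let $$\Omega_h:=\{(x,y):0\le x<\ell,\ 0<y<h(x)\},\qquad \Omega_h^\#:=\{(x,y):x\in\mathbb R,\ 0<y<h(x)\},$$ $$\Gamma_h:=\{(x,y):x\in[0,\ell),\ h^-(x)\le y\le h^+(x)\},\qquad \Sigma_h:=\{(x,y):x\in[0,\ell),\ h(x)<h^-(x),\ h(x)\le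 y\le h^-(x)\}.$$ *Dislocations.* $\mathcal M_{dis}(\Omega_h;\mathbf B)$ is the set of $\mathbb R^2$-valued measures $\sigma=\sum_{i=1}^k\mathbf b_i\delta^\#_{z_i}$, where $\delta^\#_z:=\sum_{m\in\mathbb Z}\delta_{z+m\ell\mathbf e_1}$ and the (not necessarily distinct) centers satisfy $z_i\in\Omega_h$ and $B_{r_0}(z_i)\subset\Omega_h^\#$. *Admissible configurations.* For a matrix field $H$, $\operatorname{curl}H:=(\partial_xH_{12}-\partial_yH_{11},\ \partial_xH_{22}-\partial_yH_{21})$ in the sense of distributions, and $H^\#$ is the $\ell$-periodic extension of $H$ in $x$. $X(e_0;\mathbf B)$ is the set of triples $(h,\sigma,H)$ such that $h\in AP(0,\ell)$, $\sigma\in\mathcal M_{dis}(\Omega_h;\mathbf B)$, $H:\Omega_h\to\mathbb R^{2\times2}$ with $H^\#$ square integrable on the compact subsets of $\{(x,y):0\le y<h(x)\}$, $\operatorname{curl}H\in L^2(\Omega_h;\mathbb R^2)$, $\operatorname{curl}H^\#\in L^2_{loc}(\Omega_h^\#;\mathbb R^2)$, $\operatorname{curl}H^\#=\sigma*\varrho_{r_0}$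 in $\Omega_h^\#$, and $H[\mathbf e_1]=e_0\mathbf e_1$ on $\{y=0\}$ in the sense of the tangential trace, that is, for every $\varphi\in C_c^\infty(\{(x,y):y<h(x)\})$ and $i=1,2$, $$\int_{\Omega_h^\#}\bigl(H^\#_{i1}\partial_y\varphi-H^\#_{i2}\partial_x\varphi\bigr)\,dz+\int_{\mathbb R}e_0(\mathbf e_1)_i\,\varphi(x,0)\,dx=\int_{\Omega_h^\#}(\sigma*\varrho_{r_0})_i\,\varphi\,dz .$$ *Energy.* With $W(E):=\mu|E|^2+\frac{\lambda}{2}(\operatorname{tr}E)^2$ and $H_{sym}:=\frac12(H+H^T)$, let $$F(h,\sigma,H):=\int_{\Omega_h}W(H_{sym})\,dz+\gamma\mathcal H^1(\Gamma_h)+2\gamma\mathcal H^1(\Sigma_h)\in[0,\infty].$$ Let $v_0(x,y):=\bigl(x,\frac{-\lambda y}{2\mu+\lambda}\bigr)$ and $W_0:=W((Dv_0)_{sym})$. **Theorem.** Let $d>0$ and let $(\bar h,\bar\sigma,\bar H)$ be a minimizer of $$\min\{F(h,\sigma,H):\ (h,\sigma,H)\in X(e_0;\mathbf B),\ |\Omega_h|=d\}.$$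 Then, for every $\Lambda>e_0^2W_0$, $(\bar h,\bar\sigma,\bar H)$ is also a minimizer of $$\min\bigl\{F(h,\sigma,H)+\Lambda\,(d-|\Omega_h|):\ (h,\sigma,H)\in X(e_0;\mathbf B),\ |\Omega_h|\le d\bigr\}.$$ -/

import Mathlib

open MeasureTheory Set
open scoped CompactlySupported ContDiff

noncomputable section

namespace EpitaxialFilm

/-- The plane `ℝ²` with its Euclidean norm; `z 0` is the abscissa `x`, `z 1` the ordinate `y`. -/
abbrev Plane := EuclideanSpace ℝ (Fin 2)

/-- `2 × 2` real matrices. -/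
abbrev Mat := Matrix (Fin 2) (Fin 2) ℝ

/-- The `i`-th vector of the canonical basis (`basisVec 0` is `𝐞₁`, `basisVec 1` is `𝐞₂`). -/
def basisVec (i : Fin 2) : Plane := EuclideanSpace.single i 1

/-- The fixed data of the model, with the standing assumptions on them. -/
structure FilmData where
  /-- the period `ℓ` -/
  ell : ℝ
  /-- the core radius `r₀` of the dislocations -/
  r0 : ℝ
  /-- first Lamé coefficient `μ` -/
  mu : ℝ
  /-- second Lamé coefficient `λ` -/
  lam : ℝ
  /-- the surface tension `γ` -/
  gam : ℝ
  /-- the lattice mismatch `e₀` -/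
  e0 : ℝ
  /-- the mollifier `ϱ` -/
  rho : Plane → ℝ
  ell_pos : 0 < ell
  r0_pos : 0 < r0
  r0_lt : r0 < ell / 2
  mu_pos : 0 < mu
  mu_add_lam_pos : 0 < mu + lam
  gam_pos : 0 < gam
  e0_ne : e0 ≠ 0
  rho_smooth : ContDiff ℝ ∞ rho
  rho_compact : HasCompactSupport rho
  rho_support : tsupport rho ⊆ Metric.ball 0 1
  rho_nonneg : ∀ z, 0 ≤ rho z
  rho_radial : ∀ z w, ‖z‖ = ‖w‖ → rho z = rho w
  rho_integral : ∫ z, rho z = 1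

/-! ### Profiles -/

/-- Admissible profiles `AP(0,ℓ)`. The variation is the pointwise one on the open interval. -/
structure IsProfile (ell : ℝ) (h : ℝ → ℝ) : Prop where
  nonneg : ∀ x, 0 ≤ h x
  lsc : LowerSemicontinuous h
  periodic : Function.Periodic h ell
  bddVar : BoundedVariationOn h (Ioo 0 ell)

/-- `h⁺`, the larger of the two one-sided limits. -/
def upperLim (h : ℝ → ℝ) (x : ℝ) : ℝ := max (Function.rightLim h x) (Function.leftLim h x)

/-- `h⁻`, the smaller of the two one-sided limits. -/
def lowerLim (h : ℝ → ℝ) (x : ℝ) : ℝ := min (Function.rightLim h x) (Function.leftLim h x)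

/-- The film `Ω_h` over one period. -/
def film (ell : ℝ) (h : ℝ → ℝ) : Set Plane := {z | z 0 ∈ Ico 0 ell ∧ 0 < z 1 ∧ z 1 < h (z 0)}

/-- The periodic film `Ω_h^#`. -/
def filmPer (h : ℝ → ℝ) : Set Plane := {z | 0 < z 1 ∧ z 1 < h (z 0)}

/-- The periodic film together with the part of the interface `{y = 0}` lying below it. -/
def filmBase (h : ℝ → ℝ) : Set Plane := {z | 0 ≤ z 1 ∧ z 1 < h (z 0)}

/-- Everything strictly below the profile, substrate included. -/
def subgraph (h : ℝ → ℝ) : Set Plane := {z | z 1 < h (z 0)}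

/-- `Γ_h`. -/
def graphSet (ell : ℝ) (h : ℝ → ℝ) : Set Plane :=
  {z | z 0 ∈ Ico 0 ell ∧ lowerLim h (z 0) ≤ z 1 ∧ z 1 ≤ upperLim h (z 0)}

/-- The vertical cracks `Σ_h`. -/
def crackSet (ell : ℝ) (h : ℝ → ℝ) : Set Plane :=
  {z | z 0 ∈ Ico 0 ell ∧ h (z 0) < lowerLim h (z 0) ∧ h (z 0) ≤ z 1 ∧ z 1 ≤ lowerLim h (z 0)}

/-! ### Elastic energy density -/

/-- The symmetric part of a matrix. -/
def symPart (A : Mat) : Mat := (1 / 2 : ℝ) • (A + A.transpose)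

/-- `W(E) = μ |E|² + (λ/2) (tr E)²`, with the Frobenius norm. -/
def elasticDensity (mu lam : ℝ) (E : Mat) : ℝ :=
  mu * ∑ i, ∑ j, E i j ^ 2 + lam / 2 * E.trace ^ 2

/-- The Jacobian matrix `Du`. -/
def jacobian (u : Plane → Plane) (z : Plane) : Mat :=
  Matrix.of fun i j => fderiv ℝ u z (basisVec j) i

/-- The flat elastic equilibrium `v₀(x,y) = (x, -λ y / (2μ+λ))`. -/
def flatEquilibrium (mu lam : ℝ) (z : Plane) : Plane := !₂[z 0, -lam * z 1 / (2 * mu + lam)]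

/-- `W₀ = W(E(v₀))`; as `v₀` is linear, its strain is constant, and it is read off at the origin. -/
def FilmData.W0 (P : FilmData) : ℝ :=
  elasticDensity P.mu P.lam (symPart (jacobian (flatEquilibrium P.mu P.lam) 0))

/-! ### Dislocation measures -/

/-- `ℝ²`-valued Radon measures on the plane, seen (Riesz) as linear functionals on the continuous
compactly supported functions. -/
abbrev VecMeasure := C_c(Plane, ℝ) →ₗ[ℝ] Plane

/-- A compactly supported function meets only finitely many points of a periodic row. -/
theorem finite_row {ell : ℝ} (hell : 0 < ell) (z : Plane) (φ : C_c(Plane, ℝ)) :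
    (Function.support fun m : ℤ => φ (z + ((m : ℝ) * ell) • basisVec 0)).Finite := by
  obtain ⟨R, hR⟩ := (show IsCompact (tsupport φ) from φ.hasCompactSupport).isBounded.exists_norm_le
  refine (Set.finite_Icc (-⌈(R + ‖z‖) / ell⌉) ⌈(R + ‖z‖) / ell⌉).subset ?_
  intro m hm
  have h1 := hR _ (subset_tsupport _ hm)
  have h2 : ‖((m : ℝ) * ell) • basisVec 0‖ = |(m : ℝ)| * ell := by
    simp [basisVec, norm_smul, abs_of_pos hell]
  have h3 : |(m : ℝ)| * ell ≤ R + ‖z‖ := by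
    rw [← h2]
    calc _ = ‖(z + ((m : ℝ) * ell) • basisVec 0) - z‖ := by congr 1; abel
      _ ≤ _ := (norm_sub_le _ _).trans (by linarith)
  have h4 : |(m : ℝ)| ≤ ⌈(R + ‖z‖) / ell⌉ := ((le_div_iff₀ hell).2 h3).trans (Int.le_ceil _)
  have h5 := abs_le.1 h4
  exact ⟨by exact_mod_cast h5.1, by exact_mod_cast h5.2⟩

/-- The periodic Dirac mass `δ_z^# = ∑_{m ∈ ℤ} δ_{z + m ℓ 𝐞₁}`. -/
def periodicDirac {ell : ℝ} (hell : 0 < ell) (z : Plane) : C_c(Plane, ℝ) →ₗ[ℝ] ℝ where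
  toFun φ := ∑ᶠ m : ℤ, φ (z + ((m : ℝ) * ell) • basisVec 0)
  map_add' φ ψ := finsum_add_distrib (finite_row hell z φ) (finite_row hell z ψ)
  map_smul' c φ := (smul_finsum c fun m : ℤ => φ (z + ((m : ℝ) * ell) • basisVec 0)).symm

/-- The measure `∑ᵢ bᵢ δ_{zᵢ}^#`. -/
def dislocationMeasure {ell : ℝ} (hell : 0 < ell) {k : ℕ} (b z : Fin k → Plane) : VecMeasure :=
  ∑ i, (periodicDirac hell (z i)).smulRight (b i)

/-- `M_dis(Ω_h; 𝐁)`: centres in `Ω_h`, possibly repeated, with cores contained in `Ω_h^#`. -/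
def dislocationMeasures (P : FilmData) (h : ℝ → ℝ) {k : ℕ} (b : Fin k → Plane) :
    Set VecMeasure :=
  {σ | ∃ z : Fin k → Plane,
    (∀ i, z i ∈ film P.ell h ∧ Metric.ball (z i) P.r0 ⊆ filmPer h) ∧
    σ = dislocationMeasure P.ell_pos b z}

/-- The rescaled mollifier `ϱ_{r₀}(z) = r₀⁻² ϱ(z / r₀)`. -/
def FilmData.mollifier (P : FilmData) (z : Plane) : ℝ := (P.r0 ^ 2)⁻¹ * P.rho (P.r0⁻¹ • z)

/-- The function `w ↦ ϱ_{r₀}(z - w)`, as a test function. -/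
def FilmData.reflectedMollifier (P : FilmData) (z : Plane) : C_c(Plane, ℝ) where
  toFun w := P.mollifier (z - w)
  continuous_toFun := by
    have := P.rho_smooth.continuous
    unfold FilmData.mollifier
    fun_prop
  hasCompactSupport' := by
    have h1 : HasCompactSupport fun w : Plane => P.rho (P.r0⁻¹ • w) :=
      P.rho_compact.comp_homeomorph (Homeomorph.smulOfNeZero _ (inv_ne_zero P.r0_pos.ne'))
    have h2 : HasCompactSupport fun w : Plane => P.rho (P.r0⁻¹ • (z - w)) :=
      h1.comp_homeomorph (Homeomorph.subLeft z)
    exact h2.mul_left (f := fun _ => (P.r0 ^ 2)⁻¹)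

/-- The convolution `σ * ϱ_{r₀}`, that is `z ↦ ∫ ϱ_{r₀}(z - w) dσ(w)`. -/
def convMollifier (P : FilmData) (σ : VecMeasure) (z : Plane) : Plane :=
  σ (P.reflectedMollifier z)

/-! ### Strain fields -/

/-- The periodic extension `H^#` of a field given over `0 ≤ x < ℓ`. -/
def periodicExt (ell : ℝ) (H : Plane → Mat) (z : Plane) : Mat :=
  H (z - ((⌊z 0 / ell⌋ : ℝ) * ell) • basisVec 0)

/-- Smooth functions with compact support contained in `U`. -/
def IsTest (U : Set Plane) (φ : Plane → ℝ) : Prop :=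
  ContDiff ℝ ∞ φ ∧ HasCompactSupport φ ∧ tsupport φ ⊆ U

/-- The partial derivative of `φ` in the direction of the `j`-th axis. -/
def pderiv (j : Fin 2) (φ : Plane → ℝ) (z : Plane) : ℝ := fderiv ℝ φ z (basisVec j)

/-- `curl H = f` in the open set `U`, in the sense of distributions, where
`(curl H)ᵢ = ∂ₓ Hᵢ₂ - ∂_y Hᵢ₁`. -/
def HasWeakCurl (U : Set Plane) (H : Plane → Mat) (f : Plane → Plane) : Prop :=
  ∀ φ, IsTest U φ → ∀ i : Fin 2,
    ∫ z in U, (H z i 0 * pderiv 1 φ z - H z i 1 * pderiv 0 φ z) = ∫ z in U, f z i * φ z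

/-- The field `H` on `Ω_h^#`, whose curl is `f`, has tangential trace `H[𝐞₁] = v` on `{y = 0}`:
this is Green's formula, for test functions that vanish near the profile but need not vanish
on `{y = 0}`. -/
def HasTangentialTrace (h : ℝ → ℝ) (H : Plane → Mat) (f : Plane → Plane) (v : Plane) : Prop :=
  ∀ φ, IsTest (subgraph h) φ → ∀ i : Fin 2,
    (∫ z in filmPer h, (H z i 0 * pderiv 1 φ z - H z i 1 * pderiv 0 φ z))
      + ∫ x : ℝ, v i * φ !₂[x, 0] = ∫ z in filmPer h, f z i * φ z

/-- The space `𝐇_#(curl; Ω_h; 𝕄^{2×2})`. Local square integrability of the field is understood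
up to the interface `{y = 0}` and, periodically, up to the lateral sides (but not up to the
profile), so that a tangential trace on `{y = 0}` makes sense. -/
def MemHcurl (ell : ℝ) (h : ℝ → ℝ) (H : Plane → Mat) : Prop :=
  (∀ K, IsCompact K → K ⊆ filmBase h → ∀ i j,
    MemLp (fun z => periodicExt ell H z i j) 2 (volume.restrict K)) ∧
  ∃ f : Plane → Plane, HasWeakCurl (filmPer h) (periodicExt ell H) f ∧
    MemLp f 2 (volume.restrict (film ell h)) ∧
    ∀ K, IsCompact K → K ⊆ filmPer h → MemLp f 2 (volume.restrict K)

/-! ### Admissible configurations and energy -/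

/-- Triples `(h, σ, H)`; only the values of `H` on `Ω_h` matter. -/
structure Config where
  /-- the profile -/
  h : ℝ → ℝ
  /-- the dislocation measure -/
  σ : VecMeasure
  /-- the strain field -/
  H : Plane → Mat

/-- The class `X(e₀; 𝐁)`. -/
structure IsAdmissible (P : FilmData) {k : ℕ} (b : Fin k → Plane) (c : Config) : Prop where
  profile : IsProfile P.ell c.h
  measure : c.σ ∈ dislocationMeasures P c.h b
  memHcurl : MemHcurl P.ell c.h c.H
  curl_eq : HasWeakCurl (filmPer c.h) (periodicExt P.ell c.H) (convMollifier P c.σ)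
  trace_eq : HasTangentialTrace c.h (periodicExt P.ell c.H) (convMollifier P c.σ)
    (P.e0 • basisVec 0)

/-- The total energy `F(h, σ, H)`, with values in `[0, ∞]`. -/
def energy (P : FilmData) (c : Config) : ENNReal :=
  (∫⁻ z in film P.ell c.h, ENNReal.ofReal (elasticDensity P.mu P.lam (symPart (c.H z))))
    + ENNReal.ofReal P.gam * Measure.hausdorffMeasure 1 (graphSet P.ell c.h)
    + 2 * ENNReal.ofReal P.gam * Measure.hausdorffMeasure 1 (crackSet P.ell c.h)

/-- Admissible configurations with `|Ω_h| = d`. -/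
def classEq (P : FilmData) {k : ℕ} (b : Fin k → Plane) (d : ℝ) : Set Config :=
  {c | IsAdmissible P b c ∧ volume (film P.ell c.h) = ENNReal.ofReal d}

/-- Admissible configurations with `|Ω_h| ≤ d`. -/
def classLe (P : FilmData) {k : ℕ} (b : Fin k → Plane) (d : ℝ) : Set Config :=
  {c | IsAdmissible P b c ∧ volume (film P.ell c.h) ≤ ENNReal.ofReal d}

/-- The penalized energy `F(h, σ, H) + Λ (d - |Ω_h|)`, considered on `{|Ω_h| ≤ d}`. -/
def penalizedEnergy (P : FilmData) (Λ d : ℝ) (c : Config) : ENNReal :=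
  energy P c + ENNReal.ofReal (Λ * (d - volume.real (film P.ell c.h)))

/-- `c` is a minimizer of `f` over the class `S`. -/
def IsMinimizer (S : Set Config) (f : Config → ENNReal) (c : Config) : Prop :=
  c ∈ S ∧ ∀ c' ∈ S, f c ≤ f c'

end EpitaxialFilm

end

/-!
A competitor of area `v ≤ d` is raised by `t = (d - v) / ℓ`, and the strip of height `t` left below
it is filled with the constant strain `e₀ Dv₀` of the flat equilibrium. The area becomes `d`, the
surface energy is translation invariant, and the elastic energy grows by
`e₀² W₀ ℓ t = e₀² W₀ (d - v)`, which the penalty `Λ (d - v)` of the competitor outweighs. The raised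
configuration is admissible because the strip field has tangential trace `e₀ 𝐞₁` on both `{y = 0}`
and `{y = t}`: by Green's formula the junction carries no curl. Nor do the mollified dislocations
enter the strip, since their cores lie inside the film.
-/

open Filter Topology Function

noncomputable section

namespace EpitaxialFilm

section General

theorem leftLim_homeomorph_comp {α β γ : Type*} [LinearOrder α] [TopologicalSpace β] [T2Space β]
    [TopologicalSpace γ] [T2Space γ] (e : β ≃ₜ γ) (f : α → β) (a : α) :
    leftLim (fun x => e (f x)) a = e (leftLim f a) := by
  let _ : TopologicalSpace α := Preorder.topology α
  have : OrderTopology α := ⟨rfl⟩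
  rcases eq_or_neBot (𝓝[<] a) with hbot | hbot
  · rw [leftLim_eq_of_eq_bot _ hbot, leftLim_eq_of_eq_bot _ hbot]
  by_cases hlim : ∃ y, Tendsto f (𝓝[<] a) (𝓝 y)
  · obtain ⟨y, hy⟩ := hlim
    rw [leftLim_eq_of_tendsto hy]
    exact leftLim_eq_of_tendsto ((e.continuous.tendsto y).comp hy)
  · rw [leftLim_eq_of_not_tendsto _ hlim, leftLim_eq_of_not_tendsto]
    rintro ⟨y, hy⟩
    exact hlim ⟨e.symm y, by simpa [comp_def] using (e.symm.continuous.tendsto y).comp hy⟩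

theorem rightLim_homeomorph_comp {α β γ : Type*} [LinearOrder α] [TopologicalSpace β] [T2Space β]
    [TopologicalSpace γ] [T2Space γ] (e : β ≃ₜ γ) (f : α → β) (a : α) :
    rightLim (fun x => e (f x)) a = e (rightLim f a) :=
  leftLim_homeomorph_comp (α := αᵒᵈ) e f a

theorem tendsto_intCast_smul_cofinite_cocompact {E : Type*} [AddCommGroup E] [Module ℝ E]
    [TopologicalSpace E] [IsTopologicalAddGroup E] [ContinuousSMul ℝ E] [T2Space E] {v : E}
    (hv : v ≠ 0) : Tendsto (fun m : ℤ => (m : ℝ) • v) cofinite (cocompact E) :=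
  (isClosedEmbedding_smul_left hv).tendsto_cocompact.comp Int.tendsto_coe_cofinite

theorem continuous_finsum_comp_sub {ι G E : Type*} [AddGroup G] [TopologicalSpace G]
    [IsTopologicalAddGroup G] [WeaklyLocallyCompactSpace G] [AddCommMonoid E] [TopologicalSpace E]
    [ContinuousAdd E] {f : G → E} (hf : Continuous f) (hc : HasCompactSupport f) {u : ι → G}
    (hu : Tendsto u cofinite (cocompact G)) : Continuous fun w => ∑ᶠ m, f (w - u m) := by
  refine continuous_finsum (fun m => hf.comp (continuous_sub_right (u m))) fun w => ?_
  obtain ⟨N, hN, hwN⟩ := exists_compact_mem_nhds w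
  have hK : IsCompact (-tsupport f) := IsCompact.neg hc
  refine ⟨N, hwN, (tendsto_cofinite_cocompact_iff.1 hu _ (hK.add hN)).subset ?_⟩
  rintro m ⟨v, hv, hvN⟩
  have hvm : -(v - u m) ∈ -tsupport f := Set.neg_mem_neg.2 (subset_tsupport f hv)
  simpa using Set.add_mem_add hvm hvN

theorem memLp_restrict_of_continuousOn {X E : Type*} [TopologicalSpace X] [T2Space X]
    [MeasurableSpace X] [OpensMeasurableSpace X] [NormedAddCommGroup E] {μ : Measure X}
    [IsFiniteMeasureOnCompacts μ] {K : Set X} (hK : IsCompact K) {f : X → E}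
    (hf : ContinuousOn f K) (p : ENNReal) : MemLp f p (μ.restrict K) := by
  have : IsFiniteMeasure (μ.restrict K) := isFiniteMeasure_restrict.2 hK.measure_lt_top.ne
  obtain ⟨C, hC⟩ := hK.exists_bound_of_continuousOn hf
  exact .of_bound (hf.aestronglyMeasurable_of_isCompact hK hK.measurableSet) C
    (ae_restrict_of_forall_mem hK.measurableSet hC)

theorem map_add_right_restrict_preimage {G : Type*} [AddGroup G] [MeasurableSpace G]
    [MeasurableAdd G] (μ : Measure G) [μ.IsAddRightInvariant] (v : G) (S : Set G) :
    (μ.restrict ((· + v) ⁻¹' S)).map (· + v) = μ.restrict S := by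
  rw [← (measurableEmbedding_addRight v).restrict_map, map_add_right_eq_self]

end General

section Plane

/-- The vertical vector of height `t`, along which films are raised. -/
def vert (t : ℝ) : Plane := t • basisVec 1

@[simp] theorem vert_apply_zero (t : ℝ) : vert t 0 = 0 := by simp [vert, basisVec]

@[simp] theorem vert_apply_one (t : ℝ) : vert t 1 = t := by simp [vert, basisVec]

@[fun_prop]
theorem continuous_coord (i : Fin 2) : Continuous fun z : Plane => z i :=
  (EuclideanSpace.proj (𝕜 := ℝ) i).continuous

@[fun_prop]
theorem measurable_coord (i : Fin 2) : Measurable fun z : Plane => z i :=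
  (continuous_coord i).measurable

theorem vec_eq_smul_add_smul (x y : ℝ) : (!₂[x, y] : Plane) = x • basisVec 0 + y • basisVec 1 := by
  ext i; fin_cases i <;> simp [basisVec]

theorem vec_add_vert (x y t : ℝ) : (!₂[x, y] : Plane) + vert t = !₂[x, y + t] := by
  rw [vec_eq_smul_add_smul, vec_eq_smul_add_smul, vert, add_smul, add_assoc]

/-- The measurable identification of the plane with `ℝ × ℝ` by its two coordinates. -/
def planeEquivProd : Plane ≃ᵐ ℝ × ℝ :=
  (MeasurableEquiv.toLp 2 (Fin 2 → ℝ)).symm.trans MeasurableEquiv.finTwoArrow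

theorem measurePreserving_planeEquivProd : MeasurePreserving planeEquivProd :=
  (volume_preserving_finTwoArrow ℝ).comp
    (EuclideanSpace.volume_preserving_symm_measurableEquiv_toLp (Fin 2))

theorem volume_coord_box (s t : Set ℝ) :
    volume {z : Plane | z 0 ∈ s ∧ z 1 ∈ t} = volume s * volume t := by
  rw [← Measure.prod_prod, ← Measure.volume_eq_prod]
  exact measurePreserving_planeEquivProd.measure_preimage_equiv (s ×ˢ t)

theorem volume_horizontal_line (t : ℝ) : volume {z : Plane | z 1 = t} = 0 := by
  simpa using volume_coord_box univ {t}

theorem volume_film_const (ell t : ℝ) :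
    volume (film ell fun _ => t) = ENNReal.ofReal ell * ENNReal.ofReal t := by
  have hbox := volume_coord_box (Ico 0 ell) (Ioo 0 t)
  rwa [Real.volume_Ico, Real.volume_Ioo, sub_zero, sub_zero] at hbox

theorem preimage_planeEquivProd_symm_filmPer_const (t : ℝ) :
    planeEquivProd.symm ⁻¹' filmPer (fun _ => t) = (univ : Set ℝ) ×ˢ Ioo 0 t := by
  ext p
  exact (and_iff_right (mem_univ p.1)).symm

theorem integrableOn_prod_of_integrableOn_filmPer_const {t : ℝ} {g : Plane → ℝ}
    (hg : IntegrableOn g (filmPer fun _ => t)) :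
    IntegrableOn (fun p : ℝ × ℝ => g !₂[p.1, p.2]) (univ ×ˢ Ioo 0 t) := by
  rw [← preimage_planeEquivProd_symm_filmPer_const]
  exact (measurePreserving_planeEquivProd.symm.integrableOn_comp_preimage
    planeEquivProd.symm.measurableEmbedding).2 hg

theorem setIntegral_filmPer_const_eq_prod (t : ℝ) (g : Plane → ℝ) :
    ∫ z in filmPer fun _ => t, g z = ∫ p in (univ : Set ℝ) ×ˢ Ioo 0 t, g !₂[p.1, p.2] := by
  rw [← measurePreserving_planeEquivProd.symm.setIntegral_preimage_emb
    planeEquivProd.symm.measurableEmbedding, preimage_planeEquivProd_symm_filmPer_const]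
  rfl

theorem setIntegral_filmPer_const {t : ℝ} {g : Plane → ℝ}
    (hg : IntegrableOn g (filmPer fun _ => t)) :
    ∫ z in filmPer fun _ => t, g z = ∫ x : ℝ, ∫ y in Ioo 0 t, g !₂[x, y] := by
  rw [setIntegral_filmPer_const_eq_prod, Measure.volume_eq_prod,
    setIntegral_prod _ (integrableOn_prod_of_integrableOn_filmPer_const hg), setIntegral_univ]

theorem setIntegral_filmPer_const_swap {t : ℝ} {g : Plane → ℝ}
    (hg : IntegrableOn g (filmPer fun _ => t)) :
    ∫ z in filmPer fun _ => t, g z = ∫ y in Ioo 0 t, ∫ x : ℝ, g !₂[x, y] := by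
  have hprod := integrableOn_prod_of_integrableOn_filmPer_const hg
  rw [IntegrableOn, Measure.volume_eq_prod, ← Measure.prod_restrict, Measure.restrict_univ] at hprod
  rw [setIntegral_filmPer_const_eq_prod, Measure.volume_eq_prod, ← Measure.prod_restrict,
    Measure.restrict_univ, integral_prod_symm _ hprod]

end Plane

section Green

variable {φ : Plane → ℝ}

theorem continuous_pderiv (hφ : ContDiff ℝ 1 φ) (j : Fin 2) : Continuous (pderiv j φ) :=
  (hφ.continuous_fderiv one_ne_zero).clm_apply continuous_const

theorem hasCompactSupport_pderiv (hc : HasCompactSupport φ) (j : Fin 2) :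
    HasCompactSupport (pderiv j φ) := hc.fderiv_apply ℝ _

theorem tsupport_pderiv_subset (φ : Plane → ℝ) (j : Fin 2) :
    tsupport (pderiv j φ) ⊆ tsupport φ := tsupport_fderiv_apply_subset ℝ _

theorem integrable_pderiv (hφ : ContDiff ℝ 1 φ) (hc : HasCompactSupport φ) (j : Fin 2) :
    Integrable (pderiv j φ) :=
  (continuous_pderiv hφ j).integrable_of_hasCompactSupport (hasCompactSupport_pderiv hc j)

theorem pderiv_comp_add_right (j : Fin 2) (v z : Plane) :
    pderiv j (fun w => φ (w + v)) z = pderiv j φ (z + v) := by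
  simp only [pderiv, fderiv_comp_add_right]

theorem hasDerivAt_comp_vec_left {x y : ℝ} (hφ : DifferentiableAt ℝ φ !₂[x, y]) :
    HasDerivAt (fun s => φ !₂[s, y]) (pderiv 0 φ !₂[x, y]) x := by
  refine hφ.hasFDerivAt.comp_hasDerivAt x ?_
  simp only [vec_eq_smul_add_smul]
  simpa using ((hasDerivAt_id x).smul_const (basisVec 0)).add_const (y • basisVec 1)

theorem hasDerivAt_comp_vec_right {x y : ℝ} (hφ : DifferentiableAt ℝ φ !₂[x, y]) :
    HasDerivAt (fun s => φ !₂[x, s]) (pderiv 1 φ !₂[x, y]) y := by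
  refine hφ.hasFDerivAt.comp_hasDerivAt y ?_
  simp only [vec_eq_smul_add_smul]
  simpa using ((hasDerivAt_id y).smul_const (basisVec 1)).const_add (x • basisVec 0)

theorem isClosedEmbedding_vec_left (y : ℝ) : IsClosedEmbedding fun x : ℝ => (!₂[x, y] : Plane) :=
  LeftInverse.isClosedEmbedding (f := fun z : Plane => z 0) (fun _ => by simp)
    (continuous_coord 0) (by fun_prop)

theorem integrable_comp_vec_left (hφ : Continuous φ) (hc : HasCompactSupport φ) (y : ℝ) :
    Integrable fun x : ℝ => φ !₂[x, y] :=
  (hφ.comp (isClosedEmbedding_vec_left y).continuous).integrable_of_hasCompactSupport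
    (hc.comp_isClosedEmbedding (isClosedEmbedding_vec_left y))

theorem setIntegral_filmPer_const_pderiv_zero (hφ : ContDiff ℝ 1 φ) (hc : HasCompactSupport φ)
    (t : ℝ) : ∫ z in filmPer fun _ => t, pderiv 0 φ z = 0 := by
  rw [setIntegral_filmPer_const_swap (integrable_pderiv hφ hc 0).integrableOn]
  refine integral_eq_zero_of_ae (.of_forall fun y => ?_)
  exact integral_eq_zero_of_hasDerivAt_of_integrable
    (fun x => hasDerivAt_comp_vec_left (hφ.differentiable one_ne_zero _))
    (integrable_comp_vec_left (continuous_pderiv hφ 0) (hasCompactSupport_pderiv hc 0) y)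
    (integrable_comp_vec_left hφ.continuous hc y)

theorem setIntegral_filmPer_const_pderiv_one (hφ : ContDiff ℝ 1 φ) (hc : HasCompactSupport φ)
    {t : ℝ} (ht : 0 ≤ t) :
    ∫ z in filmPer fun _ => t, pderiv 1 φ z = (∫ x : ℝ, φ !₂[x, t]) - ∫ x : ℝ, φ !₂[x, 0] := by
  rw [setIntegral_filmPer_const (integrable_pderiv hφ hc 1).integrableOn,
    ← integral_sub (integrable_comp_vec_left hφ.continuous hc t)
      (integrable_comp_vec_left hφ.continuous hc 0)]
  refine integral_congr_ae (.of_forall fun x => ?_)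
  dsimp only
  rw [← integral_Ioc_eq_integral_Ioo, ← intervalIntegral.integral_of_le ht]
  exact intervalIntegral.integral_eq_sub_of_hasDerivAt
    (fun y _ => hasDerivAt_comp_vec_right (hφ.differentiable one_ne_zero _))
    (((continuous_pderiv hφ 1).comp (by fun_prop)).intervalIntegrable _ _)

end Green

section Raising

variable {ell t : ℝ} {h : ℝ → ℝ}

theorem measurableSet_filmPer (hm : Measurable h) : MeasurableSet (filmPer h) :=
  (measurableSet_lt measurable_const (measurable_coord 1)).inter
    (measurableSet_lt (measurable_coord 1) (hm.comp (measurable_coord 0)))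

theorem measurableSet_column (ell : ℝ) : MeasurableSet {z : Plane | z 0 ∈ Ico 0 ell} :=
  measurable_coord 0 measurableSet_Ico

theorem measurableSet_film (hm : Measurable h) : MeasurableSet (film ell h) :=
  (measurableSet_column ell).inter (measurableSet_filmPer hm)

theorem restrict_film (ell : ℝ) (h : ℝ → ℝ) :
    volume.restrict (film ell h)
      = (volume.restrict (filmPer h)).restrict {z | z 0 ∈ Ico 0 ell} :=
  (Measure.restrict_restrict (measurableSet_column ell)).symm

theorem sub_vert_mem_filmPer {z : Plane} :
    z - vert t ∈ filmPer h ↔ t < z 1 ∧ z 1 < h (z 0) + t := by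
  simp [filmPer, sub_lt_iff_lt_add]

theorem filmPer_raise_ae_eq (h0 : ∀ x, 0 ≤ h x) (ht : 0 ≤ t) :
    filmPer (fun x => h x + t)
      =ᵐ[volume] (filmPer (fun _ => t) ∪ (· - vert t) ⁻¹' filmPer h : Set Plane) := by
  have hline : ∀ᵐ z : Plane, z 1 ≠ t := by
    rw [ae_iff]; simpa using volume_horizontal_line t
  filter_upwards [hline] with z hz
  refine propext ?_
  change (0 < z 1 ∧ z 1 < h (z 0) + t) ↔ (0 < z 1 ∧ z 1 < t) ∨ z - vert t ∈ filmPer h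
  rw [sub_vert_mem_filmPer]
  grind

theorem disjoint_filmPer_const_preimage :
    Disjoint (filmPer fun _ => t) ((· - vert t) ⁻¹' filmPer h) :=
  Set.disjoint_left.2 fun _ hz hz' => hz.2.not_gt (sub_vert_mem_filmPer.1 hz').1

theorem restrict_filmPer_raise (h0 : ∀ x, 0 ≤ h x) (ht : 0 ≤ t) :
    volume.restrict (filmPer fun x => h x + t)
      = volume.restrict (filmPer fun _ => t)
        + (volume.restrict (filmPer h)).map (· + vert t) := by
  have hpre : (· + vert t) ⁻¹' ((· - vert t) ⁻¹' filmPer h) = filmPer h := by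
    simp [← preimage_comp, comp_def]
  rw [Measure.restrict_congr_set (filmPer_raise_ae_eq h0 ht),
    Measure.restrict_union' disjoint_filmPer_const_preimage
      (measurableSet_filmPer measurable_const),
    ← map_add_right_restrict_preimage volume (vert t) ((· - vert t) ⁻¹' filmPer h), hpre]

theorem restrict_film_raise (h0 : ∀ x, 0 ≤ h x) (ht : 0 ≤ t) :
    volume.restrict (film ell fun x => h x + t)
      = volume.restrict (film ell fun _ => t)
        + (volume.restrict (film ell h)).map (· + vert t) := by
  have hcol : (· + vert t) ⁻¹' {z : Plane | z 0 ∈ Ico 0 ell} = {z | z 0 ∈ Ico 0 ell} := by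
    ext z; simp
  rw [restrict_film, restrict_film, restrict_film, restrict_filmPer_raise h0 ht,
    Measure.restrict_add,
    Measure.restrict_map (measurable_add_const _) (measurableSet_column ell), hcol]

theorem setIntegral_filmPer_raise (h0 : ∀ x, 0 ≤ h x) (ht : 0 ≤ t)
    {g : Plane → ℝ} (hlow : IntegrableOn g (filmPer fun _ => t))
    (hup : IntegrableOn (fun z => g (z + vert t)) (filmPer h)) :
    ∫ z in filmPer fun x => h x + t, g z
      = (∫ z in filmPer fun _ => t, g z) + ∫ z in filmPer h, g (z + vert t) := by
  have hemb := measurableEmbedding_addRight (vert t)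
  rw [restrict_filmPer_raise h0 ht,
    integral_add_measure hlow (hemb.integrable_map_iff.2 hup), hemb.integral_map]

theorem setLIntegral_film_raise (h0 : ∀ x, 0 ≤ h x) (ht : 0 ≤ t)
    (g : Plane → ENNReal) :
    ∫⁻ z in film ell fun x => h x + t, g z
      = (∫⁻ z in film ell fun _ => t, g z) + ∫⁻ z in film ell h, g (z + vert t) := by
  rw [restrict_film_raise h0 ht, lintegral_add_measure,
    (measurableEmbedding_addRight (vert t)).lintegral_map]

theorem volume_film_raise (h0 : ∀ x, 0 ≤ h x) (ht : 0 ≤ t) :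
    volume (film ell fun x => h x + t) = volume (film ell fun _ => t) + volume (film ell h) := by
  simpa only [setLIntegral_one] using setLIntegral_film_raise h0 ht fun _ => 1

theorem upperLim_raise (h : ℝ → ℝ) (t x : ℝ) :
    upperLim (fun x => h x + t) x = upperLim h x + t := by
  rw [upperLim, upperLim, ← max_add_add_right]
  exact congrArg₂ max (rightLim_homeomorph_comp (.addRight t) h x)
    (leftLim_homeomorph_comp (.addRight t) h x)

theorem lowerLim_raise (h : ℝ → ℝ) (t x : ℝ) :
    lowerLim (fun x => h x + t) x = lowerLim h x + t := by
  rw [lowerLim, lowerLim, ← min_add_add_right]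
  exact congrArg₂ min (rightLim_homeomorph_comp (.addRight t) h x)
    (leftLim_homeomorph_comp (.addRight t) h x)

theorem graphSet_raise (ell : ℝ) (h : ℝ → ℝ) (t : ℝ) :
    graphSet ell (fun x => h x + t) = IsometryEquiv.subRight (vert t) ⁻¹' graphSet ell h := by
  ext z
  simp [graphSet, lowerLim_raise, upperLim_raise, le_sub_iff_add_le]

theorem crackSet_raise (ell : ℝ) (h : ℝ → ℝ) (t : ℝ) :
    crackSet ell (fun x => h x + t) = IsometryEquiv.subRight (vert t) ⁻¹' crackSet ell h := by
  ext z
  simp [crackSet, lowerLim_raise, le_sub_iff_add_le]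

end Raising

section Profiles

variable {ell t : ℝ} {h : ℝ → ℝ}

theorem IsProfile.measurable (hp : IsProfile ell h) : Measurable h := hp.lsc.measurable

theorem IsProfile.raise (hp : IsProfile ell h) (ht : 0 ≤ t) : IsProfile ell fun x => h x + t where
  nonneg x := add_nonneg (hp.nonneg x) ht
  lsc := hp.lsc.add continuous_const.lowerSemicontinuous
  periodic x := congrArg (· + t) (hp.periodic x)
  bddVar := by simpa only [BoundedVariationOn, eVariationOn, edist_add_right] using hp.bddVar

theorem IsProfile.exists_forall_le (hp : IsProfile ell h) : ∃ C, ∀ x ∈ Ico 0 ell, h x ≤ C := by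
  refine ⟨max (h 0) (h (ell / 2) + (eVariationOn h (Ioo 0 ell)).toReal), fun x hx => ?_⟩
  rcases hx.1.eq_or_lt with rfl | hx0
  · exact le_max_left _ _
  · refine le_max_of_le_right (sub_le_iff_le_add'.1 (hp.bddVar.sub_le ⟨hx0, hx.2⟩ ?_))
    exact ⟨half_pos (hx0.trans hx.2), half_lt_self (hx0.trans hx.2)⟩

theorem IsProfile.exists_isCompact_film_subset (hp : IsProfile ell h) :
    ∃ K, IsCompact K ∧ film ell h ⊆ K := by
  obtain ⟨C, hC⟩ := hp.exists_forall_le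
  refine ⟨(fun p : ℝ × ℝ => !₂[p.1, p.2]) '' Icc 0 ell ×ˢ Icc 0 C,
    (isCompact_Icc.prod isCompact_Icc).image (by fun_prop), fun z hz => ?_⟩
  refine ⟨(z 0, z 1), ⟨⟨hz.1.1, hz.1.2.le⟩, hz.2.1.le, hz.2.2.le.trans (hC _ hz.1)⟩, ?_⟩
  ext i; fin_cases i <;> rfl

end Profiles

section Fields

variable {t : ℝ} {h : ℝ → ℝ} {A : Mat} {H : Plane → Mat} {φ : Plane → ℝ}

/-- Square integrability of the entries of `H` on the compact subsets of `U`: the local condition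
imposed on the strain in `MemHcurl`. -/
def LocallyL2On (U : Set Plane) (H : Plane → Mat) : Prop :=
  ∀ K, IsCompact K → K ⊆ U → ∀ i j, MemLp (fun z => H z i j) 2 (volume.restrict K)

/-- The duality integrand of the `i`-th row of `curl H` with `φ`, as it appears in `HasWeakCurl`
and `HasTangentialTrace`. -/
def curlIntegrand (H : Plane → Mat) (φ : Plane → ℝ) (i : Fin 2) (z : Plane) : ℝ :=
  H z i 0 * pderiv 1 φ z - H z i 1 * pderiv 0 φ z

/-- The field `H` raised by `t`, with the constant value `A` below height `t`. -/
def raiseField (t : ℝ) (A : Mat) (H : Plane → Mat) (z : Plane) : Mat :=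
  if z 1 < t then A else H (z - vert t)

theorem periodicExt_raiseField (ell t : ℝ) (A : Mat) (H : Plane → Mat) :
    periodicExt ell (raiseField t A H) = raiseField t A (periodicExt ell H) := by
  funext z
  have hx : (z - vert t) 0 = z 0 := by simp
  have hy : (z - ((⌊z 0 / ell⌋ : ℝ) * ell) • basisVec 0) 1 = z 1 := by simp [basisVec]
  simp only [periodicExt, raiseField, hx, hy, sub_right_comm]

theorem raiseField_of_lt {z : Plane} (hz : z 1 < t) : raiseField t A H z = A := if_pos hz

theorem raiseField_add_vert {z : Plane} (hz : 0 ≤ z 1) :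
    raiseField t A H (z + vert t) = H z := by
  rw [raiseField, if_neg (by simpa using hz), add_sub_cancel_right]

theorem LocallyL2On.raise (hH : LocallyL2On (filmBase h) H) (t : ℝ) (A : Mat) :
    LocallyL2On (filmBase fun x => h x + t) (raiseField t A H) := by
  classical
  intro K hK hKh i j
  have hS : MeasurableSet {z : Plane | z 1 < t} :=
    measurableSet_lt (measurable_coord 1) measurable_const
  have hKS : IsCompact ({z : Plane | z 1 < t}ᶜ ∩ K) :=
    hK.inter_left (isOpen_lt (continuous_coord 1) continuous_const).isClosed_compl
  have hpre : (· + vert t) ⁻¹' ({z : Plane | z 1 < t}ᶜ ∩ K) ⊆ filmBase h := fun z hz =>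
    ⟨by simpa using hz.1, by simpa using (hKh hz.2).2⟩
  have : IsFiniteMeasure (volume.restrict K) := isFiniteMeasure_restrict.2 hK.measure_lt_top.ne
  have hup : MemLp (fun z => H (z - vert t) i j) 2
      ((volume.restrict K).restrict {z : Plane | z 1 < t}ᶜ) := by
    rw [Measure.restrict_restrict hS.compl, ← map_add_right_restrict_preimage volume (vert t),
      (measurableEmbedding_addRight _).memLp_map_measure_iff]
    simpa [comp_def] using hH _ ((Homeomorph.addRight (vert t)).isCompact_preimage.2 hKS) hpre i j
  have heq : (fun z => raiseField t A H z i j)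
      = {z : Plane | z 1 < t}.piecewise (fun _ => A i j) fun z => H (z - vert t) i j := by
    ext z
    by_cases hz : z 1 < t <;> simp [raiseField, hz]
  rw [heq]
  exact MemLp.piecewise hS (memLp_const (A i j)) hup

theorem IsTest.comp_add_vert (hφ : IsTest (subgraph fun x => h x + t) φ) :
    IsTest (subgraph h) fun z => φ (z + vert t) := by
  obtain ⟨hs, hc, hsub⟩ := hφ
  refine ⟨hs.comp (contDiff_id.add contDiff_const), hc.comp_homeomorph (.addRight (vert t)), ?_⟩
  rw [show tsupport (fun z => φ (z + vert t)) = (· + vert t) ⁻¹' tsupport φ from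
    tsupport_comp_eq_preimage φ (.addRight (vert t))]
  exact fun z hz => by simpa [subgraph] using hsub hz

theorem LocallyL2On.integrableOn_mul (hH : LocallyL2On (filmBase h) H) (hm : Measurable h)
    {ψ : Plane → ℝ} (hψ : Continuous ψ) (hc : HasCompactSupport ψ) (hs : tsupport ψ ⊆ subgraph h)
    (i j : Fin 2) : IntegrableOn (fun z => H z i j * ψ z) (filmPer h) := by
  set K := tsupport ψ ∩ {z : Plane | 0 ≤ z 1}
  have hK : IsCompact K :=
    IsCompact.inter_right hc (isClosed_le continuous_const (continuous_coord 1))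
  have hHK : MemLp (fun z => H z i j) 2 (volume.restrict K) :=
    hH K hK (fun z hz => ⟨hz.2, hs hz.1⟩) i j
  have hψK : MemLp ψ 2 (volume.restrict K) := (hψ.memLp_of_hasCompactSupport hc).restrict K
  have hint : IntegrableOn (fun z => H z i j * ψ z) K := hHK.integrable_mul hψK
  refine hint.of_forall_sdiff_eq_zero (measurableSet_filmPer hm) fun z hz => ?_
  have hzψ : z ∉ tsupport ψ := fun hz' => hz.2 ⟨hz', hz.1.1.le⟩
  rw [image_eq_zero_of_notMem_tsupport hzψ, mul_zero]

theorem LocallyL2On.integrableOn_curlIntegrand (hH : LocallyL2On (filmBase h) H)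
    (hm : Measurable h) (hφ : IsTest (subgraph h) φ) (i : Fin 2) :
    IntegrableOn (curlIntegrand H φ i) (filmPer h) := by
  obtain ⟨hs, hc, hsub⟩ := hφ
  have hint (j l : Fin 2) : IntegrableOn (fun z => H z i j * pderiv l φ z) (filmPer h) :=
    hH.integrableOn_mul hm (continuous_pderiv (hs.of_le (by simp)) l)
      (hasCompactSupport_pderiv hc l) ((tsupport_pderiv_subset φ l).trans hsub) i j
  exact (hint 0 1).sub (hint 1 0)

theorem integrable_curlIntegrand_const (A : Mat) (hφ : ContDiff ℝ 1 φ) (hc : HasCompactSupport φ)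
    (i : Fin 2) : Integrable (curlIntegrand (fun _ => A) φ i) :=
  ((integrable_pderiv hφ hc 1).const_mul _).sub ((integrable_pderiv hφ hc 0).const_mul _)

theorem setIntegral_filmPer_const_curlIntegrand_const (A : Mat) (hφ : ContDiff ℝ 1 φ)
    (hc : HasCompactSupport φ) (ht : 0 ≤ t) (i : Fin 2) :
    ∫ z in filmPer fun _ => t, curlIntegrand (fun _ => A) φ i z
      = A i 0 * ((∫ x : ℝ, φ !₂[x, t]) - ∫ x : ℝ, φ !₂[x, 0]) := by
  simp only [curlIntegrand]
  rw [integral_sub ((integrable_pderiv hφ hc 1).const_mul _).integrableOn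
      ((integrable_pderiv hφ hc 0).const_mul _).integrableOn,
    integral_const_mul, integral_const_mul, setIntegral_filmPer_const_pderiv_zero hφ hc,
    setIntegral_filmPer_const_pderiv_one hφ hc ht, mul_zero, sub_zero]

theorem setIntegral_curlIntegrand_raiseField (hH : LocallyL2On (filmBase h) H) (hm : Measurable h)
    (h0 : ∀ x, 0 ≤ h x) (ht : 0 ≤ t) (A : Mat) (hφ : IsTest (subgraph fun x => h x + t) φ)
    (i : Fin 2) :
    ∫ z in filmPer fun x => h x + t, curlIntegrand (raiseField t A H) φ i z
      = A i 0 * ((∫ x : ℝ, φ !₂[x, t]) - ∫ x : ℝ, φ !₂[x, 0])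
        + ∫ z in filmPer h, curlIntegrand H (fun w => φ (w + vert t)) i z := by
  have hs : ContDiff ℝ 1 φ := hφ.1.of_le (by simp)
  have hlow : EqOn (curlIntegrand (raiseField t A H) φ i) (curlIntegrand (fun _ => A) φ i)
      (filmPer fun _ => t) := fun z hz => by
    simp only [curlIntegrand, raiseField_of_lt hz.2]
  have hup : EqOn (fun z => curlIntegrand (raiseField t A H) φ i (z + vert t))
      (curlIntegrand H (fun w => φ (w + vert t)) i) (filmPer h) := fun z hz => by
    simp only [curlIntegrand, raiseField_add_vert hz.1.le, pderiv_comp_add_right]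
  have hstrip : MeasurableSet (filmPer fun _ => t) := measurableSet_filmPer measurable_const
  have hfilm : MeasurableSet (filmPer h) := measurableSet_filmPer hm
  rw [setIntegral_filmPer_raise h0 ht
      ((integrable_curlIntegrand_const A hs hφ.2.1 i).integrableOn.congr_fun hlow.symm hstrip)
      ((hH.integrableOn_curlIntegrand hm hφ.comp_add_vert i).congr_fun hup.symm hfilm),
    setIntegral_congr_fun hstrip hlow, setIntegral_congr_fun hfilm hup,
    setIntegral_filmPer_const_curlIntegrand_const A hs hφ.2.1 ht]

theorem setIntegral_comp_sub_vert_mul {f : Plane → ℝ} (h0 : ∀ x, 0 ≤ h x) (ht : 0 ≤ t)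
    (hint : Integrable fun z => f (z - vert t) * φ z) (hf : ∀ z : Plane, z 1 ≤ 0 → f z = 0) :
    ∫ z in filmPer fun x => h x + t, f (z - vert t) * φ z
      = ∫ z in filmPer h, f z * φ (z + vert t) := by
  have hlow : ∫ z in filmPer fun _ => t, f (z - vert t) * φ z = 0 :=
    setIntegral_eq_zero_of_forall_eq_zero fun z hz => by
      rw [hf _ (by simpa using hz.2.le), zero_mul]
  rw [setIntegral_filmPer_raise h0 ht hint.integrableOn
    (hint.comp_add_right (vert t)).integrableOn, hlow, zero_add]
  simp only [add_sub_cancel_right]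

theorem HasTangentialTrace.raise {f : Plane → Plane} {v : Plane}
    (htr : HasTangentialTrace h H f v) (hH : LocallyL2On (filmBase h) H) (hm : Measurable h)
    (h0 : ∀ x, 0 ≤ h x) (ht : 0 ≤ t) (hA : ∀ i, A i 0 = v i) (hf : Continuous f)
    (hf0 : ∀ z : Plane, z 1 ≤ 0 → f z = 0) :
    HasTangentialTrace (fun x => h x + t) (raiseField t A H) (fun z => f (z - vert t)) v := by
  intro φ hφ i
  have hfield := setIntegral_curlIntegrand_raiseField hH hm h0 ht A hφ i
  have hsource := setIntegral_comp_sub_vert_mul (f := fun z => f z i) (φ := φ) h0 ht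
    (Continuous.integrable_of_hasCompactSupport (.mul (by fun_prop) hφ.1.continuous)
      hφ.2.1.mul_left) fun z hz => by rw [hf0 z hz, PiLp.zero_apply]
  have htrace := htr _ hφ.comp_add_vert i
  simp only [curlIntegrand, hA] at hfield
  simp only [vec_add_vert, zero_add, integral_const_mul] at htrace
  rw [hfield, hsource, ← htrace, integral_const_mul]
  ring

theorem HasTangentialTrace.hasWeakCurl {f : Plane → Plane} {v : Plane}
    (htr : HasTangentialTrace h H f v) : HasWeakCurl (filmPer h) H f := by
  rintro φ ⟨hs, hc, hsub⟩ i
  have hbase (x : ℝ) : φ !₂[x, 0] = 0 :=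
    image_eq_zero_of_notMem_tsupport fun hx => lt_irrefl (0 : ℝ) (hsub hx).1
  simpa [hbase] using htr φ ⟨hs, hc, hsub.trans fun z hz => hz.2⟩ i

theorem MemHcurl.of_continuous {ell : ℝ} {f : Plane → Plane} (hp : IsProfile ell h)
    (hH : LocallyL2On (filmBase h) (periodicExt ell H)) (hf : Continuous f)
    (hcurl : HasWeakCurl (filmPer h) (periodicExt ell H) f) : MemHcurl ell h H := by
  have hfK : ∀ K, IsCompact K → MemLp f 2 (volume.restrict K) := fun K hK =>
    memLp_restrict_of_continuousOn hK hf.continuousOn 2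
  obtain ⟨K, hK, hfilm⟩ := hp.exists_isCompact_film_subset
  exact ⟨hH, f, hcurl, (hfK K hK).mono_measure (Measure.restrict_mono hfilm le_rfl),
    fun K hK _ => hfK K hK⟩

end Fields

section Dislocations

variable (P : FilmData) {k : ℕ}

theorem support_mollifier_subset : support P.mollifier ⊆ Metric.ball 0 P.r0 := by
  intro z hz
  have hball := P.rho_support (subset_tsupport _ (right_ne_zero_of_mul hz))
  rwa [mem_ball_zero_iff, norm_smul, norm_inv, Real.norm_of_nonneg P.r0_pos.le,
    inv_mul_lt_iff₀ P.r0_pos, mul_one, ← mem_ball_zero_iff] at hball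

theorem hasCompactSupport_mollifier : HasCompactSupport P.mollifier :=
  .of_support_subset_isCompact (isCompact_closedBall 0 P.r0)
    ((support_mollifier_subset P).trans Metric.ball_subset_closedBall)

theorem continuous_mollifier : Continuous P.mollifier :=
  continuous_const.mul (P.rho_smooth.continuous.comp (continuous_const_smul _))

/-- The translate of the measure `σ` by the vector `v`. -/
def VecMeasure.translate (v : Plane) (σ : VecMeasure) : VecMeasure :=
  σ ∘ₗ CompactlySupportedContinuousMap.compLinearMap (Homeomorph.addRight v).toCocompactMap

theorem convMollifier_translate (v : Plane) (σ : VecMeasure) :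
    convMollifier P (VecMeasure.translate v σ) = fun w => convMollifier P σ (w - v) := by
  funext w
  refine congrArg σ (CompactlySupportedContinuousMap.ext fun u => ?_)
  exact congrArg P.mollifier (by rw [sub_sub, add_comm v u]; rfl)

theorem translate_dislocationMeasure {ell : ℝ} (hell : 0 < ell) (b z : Fin k → Plane) (v : Plane) :
    VecMeasure.translate v (dislocationMeasure hell b z)
      = dislocationMeasure hell b fun i => z i + v := by
  refine LinearMap.ext fun φ => ?_
  simp only [VecMeasure.translate, dislocationMeasure, LinearMap.comp_apply, LinearMap.sum_apply,
    LinearMap.smulRight_apply]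
  refine Finset.sum_congr rfl fun i _ => congrArg (· • b i) (finsum_congr fun m => ?_)
  exact congrArg φ (add_right_comm _ _ _)

theorem convMollifier_dislocationMeasure (b z : Fin k → Plane) (w : Plane) :
    convMollifier P (dislocationMeasure P.ell_pos b z) w
      = ∑ i, (∑ᶠ m : ℤ, P.mollifier (w - (z i + ((m : ℝ) * P.ell) • basisVec 0))) • b i := by
  simp only [convMollifier, dislocationMeasure, LinearMap.sum_apply, LinearMap.smulRight_apply]
  rfl

theorem continuous_convMollifier_dislocationMeasure (b z : Fin k → Plane) :
    Continuous (convMollifier P (dislocationMeasure P.ell_pos b z)) := by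
  have hell : P.ell • basisVec 0 ≠ 0 :=
    smul_ne_zero P.ell_pos.ne' (by simp [basisVec])
  have hrow := tendsto_intCast_smul_cofinite_cocompact hell
  have hcore (i : Fin k) : Continuous fun w =>
      ∑ᶠ m : ℤ, P.mollifier (w - (z i + ((m : ℝ) * P.ell) • basisVec 0)) := by
    simpa only [comp_def, mul_smul, sub_sub] using
      (continuous_finsum_comp_sub (continuous_mollifier P) (hasCompactSupport_mollifier P)
        hrow).comp (continuous_sub_right (z i))
  rw [funext (convMollifier_dislocationMeasure P b z)]
  exact continuous_finsetSum _ fun i _ => (hcore i).smul continuous_const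

theorem convMollifier_dislocationMeasure_eq_zero {h : ℝ → ℝ} (b : Fin k → Plane)
    {z : Fin k → Plane} (hz : ∀ i, Metric.ball (z i) P.r0 ⊆ filmPer h) {w : Plane}
    (hw : w 1 ≤ 0) : convMollifier P (dislocationMeasure P.ell_pos b z) w = 0 := by
  rw [convMollifier_dislocationMeasure]
  refine Finset.sum_eq_zero fun i _ => ?_
  rw [finsum_eq_zero_of_forall_eq_zero, zero_smul]
  intro m
  by_contra hne
  have hball : w - ((m : ℝ) * P.ell) • basisVec 0 ∈ Metric.ball (z i) P.r0 := by
    rw [mem_ball_iff_norm, sub_sub, add_comm, ← mem_ball_zero_iff]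
    exact support_mollifier_subset P hne
  exact hw.not_gt (by simpa [basisVec] using (hz i hball).1)

theorem mem_dislocationMeasures_raise {h : ℝ → ℝ} {t : ℝ} {b : Fin k → Plane} {σ : VecMeasure}
    (hσ : σ ∈ dislocationMeasures P h b) (ht : 0 ≤ t) :
    VecMeasure.translate (vert t) σ ∈ dislocationMeasures P (fun x => h x + t) b := by
  obtain ⟨z, hz, rfl⟩ := hσ
  refine ⟨_, fun i => ⟨?_, fun w hw => ?_⟩, translate_dislocationMeasure P.ell_pos b z (vert t)⟩
  · obtain ⟨hx, hy, hyh⟩ := (hz i).1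
    exact ⟨by simpa using hx, by simpa using add_pos_of_pos_of_nonneg hy ht, by simpa using hyh⟩
  · have hball : w - vert t ∈ Metric.ball (z i) P.r0 := by
      rwa [mem_ball_iff_norm, sub_sub, add_comm, ← mem_ball_iff_norm]
    have hmem := sub_vert_mem_filmPer.1 ((hz i).2 hball)
    exact ⟨ht.trans_lt hmem.1, hmem.2⟩

end Dislocations

section FlatStrain

theorem jacobian_toEuclideanCLM (M : Mat) (z : Plane) :
    jacobian (Matrix.toEuclideanCLM (𝕜 := ℝ) M) z = M := by
  ext i j
  simp only [jacobian, ContinuousLinearMap.fderiv]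
  simp [basisVec]

theorem flatEquilibrium_eq_toEuclideanCLM (mu lam : ℝ) :
    flatEquilibrium mu lam
      = Matrix.toEuclideanCLM (𝕜 := ℝ) !![1, 0; 0, -lam / (2 * mu + lam)] := by
  funext z
  ext i
  fin_cases i <;> simp [flatEquilibrium, Matrix.mulVec, Matrix.vecHead, Matrix.vecTail]
  ring

theorem symPart_smul (a : ℝ) (A : Mat) : symPart (a • A) = a • symPart A := by
  rw [symPart, symPart, Matrix.transpose_smul, ← smul_add, smul_comm]

theorem elasticDensity_smul (mu lam a : ℝ) (E : Mat) :
    elasticDensity mu lam (a • E) = a ^ 2 * elasticDensity mu lam E := by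
  simp only [elasticDensity, Matrix.trace_smul, Matrix.smul_apply, smul_eq_mul, mul_pow,
    ← Finset.mul_sum]
  ring

variable (P : FilmData)

/-- The strain `e₀ Dv₀` of the flat equilibrium with mismatch `e₀`, which fills the strip left
below a raised film. -/
def FilmData.flatStrain : Mat := P.e0 • jacobian (flatEquilibrium P.mu P.lam) 0

theorem flatStrain_apply_zero (i : Fin 2) : P.flatStrain i 0 = (P.e0 • basisVec 0) i := by
  rw [FilmData.flatStrain, flatEquilibrium_eq_toEuclideanCLM, jacobian_toEuclideanCLM]
  fin_cases i <;> simp [basisVec]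

theorem elasticDensity_flatStrain :
    elasticDensity P.mu P.lam (symPart P.flatStrain) = P.e0 ^ 2 * P.W0 := by
  rw [FilmData.flatStrain, symPart_smul, elasticDensity_smul, FilmData.W0]

end FlatStrain

section Configurations

variable (P : FilmData) {k : ℕ} {b : Fin k → Plane} {c : Config} {t : ℝ}

/-- The configuration `c` raised by `t`, with constant strain `A` in the strip `0 < y < t`. -/
def Config.raise (t : ℝ) (A : Mat) (c : Config) : Config :=
  ⟨fun x => c.h x + t, VecMeasure.translate (vert t) c.σ, raiseField t A c.H⟩

theorem IsAdmissible.raise (hc : IsAdmissible P b c) (ht : 0 ≤ t) {A : Mat}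
    (hA : ∀ i, A i 0 = (P.e0 • basisVec 0) i) : IsAdmissible P b (c.raise t A) := by
  have hσ := mem_dislocationMeasures_raise P hc.measure ht
  obtain ⟨z, hz, hσz⟩ := hc.measure
  have hcont : Continuous (convMollifier P c.σ) :=
    hσz ▸ continuous_convMollifier_dislocationMeasure P b z
  have hvanish : ∀ w : Plane, w 1 ≤ 0 → convMollifier P c.σ w = 0 := fun w hw =>
    hσz ▸ convMollifier_dislocationMeasure_eq_zero P b (fun i => (hz i).2) hw
  have hL2 : LocallyL2On (filmBase c.h) (periodicExt P.ell c.H) := hc.memHcurl.1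
  have htrace : HasTangentialTrace (c.raise t A).h (periodicExt P.ell (c.raise t A).H)
      (convMollifier P (c.raise t A).σ) (P.e0 • basisVec 0) := by
    simp only [Config.raise, periodicExt_raiseField, convMollifier_translate]
    exact hc.trace_eq.raise hL2 hc.profile.measurable hc.profile.nonneg ht hA hcont hvanish
  refine ⟨hc.profile.raise ht, hσ, .of_continuous (hc.profile.raise ht) ?_ ?_ htrace.hasWeakCurl,
    htrace.hasWeakCurl, htrace⟩
  · simpa only [Config.raise, periodicExt_raiseField] using hL2.raise t A
  · simp only [Config.raise, convMollifier_translate]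
    exact hcont.comp (continuous_sub_right _)

theorem lintegral_film_raiseField {ell : ℝ} {h : ℝ → ℝ} (hm : Measurable h) (h0 : ∀ x, 0 ≤ h x)
    (ht : 0 ≤ t) (A : Mat) (H : Plane → Mat) (w : Mat → ENNReal) :
    ∫⁻ z in film ell fun x => h x + t, w (raiseField t A H z)
      = (∫⁻ z in film ell h, w (H z)) + w A * volume (film ell fun _ => t) := by
  have hlow : ∫⁻ z in film ell fun _ => t, w (raiseField t A H z)
      = w A * volume (film ell fun _ => t) := by
    rw [← setLIntegral_const]
    exact setLIntegral_congr_fun (measurableSet_film measurable_const) fun z hz => by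
      simp only [raiseField_of_lt hz.2.2]
  have hup : ∫⁻ z in film ell h, w (raiseField t A H (z + vert t)) = ∫⁻ z in film ell h, w (H z) :=
    setLIntegral_congr_fun (measurableSet_film hm) fun z hz => by
      simp only [raiseField_add_vert hz.2.1.le]
  rw [setLIntegral_film_raise h0 ht, hlow, hup, add_comm]

theorem energy_raise (hp : IsProfile P.ell c.h) (ht : 0 ≤ t) (A : Mat) :
    energy P (c.raise t A) = energy P c
      + ENNReal.ofReal (elasticDensity P.mu P.lam (symPart A))
        * volume (film P.ell fun _ => t) := by
  have helastic := lintegral_film_raiseField (ell := P.ell) hp.measurable hp.nonneg ht A c.H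
    fun E => ENNReal.ofReal (elasticDensity P.mu P.lam (symPart E))
  simp only [energy, Config.raise, helastic, graphSet_raise, crackSet_raise,
    IsometryEquiv.hausdorffMeasure_preimage]
  ring

theorem penalizedEnergy_eq_energy {d : ℝ} (hd : 0 ≤ d) (Λ : ℝ) (hc : c ∈ classEq P b d) :
    penalizedEnergy P Λ d c = energy P c := by
  simp [penalizedEnergy, measureReal_def, hc.2, ENNReal.toReal_ofReal hd]

theorem exists_mem_classEq_energy_le_penalizedEnergy {d Λ : ℝ} (hd : 0 ≤ d)
    (hΛ : P.e0 ^ 2 * P.W0 ≤ Λ) (hc : c ∈ classLe P b d) :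
    ∃ c' ∈ classEq P b d, energy P c' ≤ penalizedEnergy P Λ d c := by
  obtain ⟨hadm, hvol⟩ := hc
  have hfin : volume (film P.ell c.h) ≠ ⊤ := (hvol.trans_lt ENNReal.ofReal_lt_top).ne
  set v := volume.real (film P.ell c.h) with hv
  have hvd : 0 ≤ d - v := sub_nonneg.2 (ENNReal.toReal_le_of_le_ofReal hd hvol)
  set t := (d - v) / P.ell
  have ht0 : 0 ≤ t := div_nonneg hvd P.ell_pos.le
  have hstrip : volume (film P.ell fun _ => t) = ENNReal.ofReal (d - v) := by
    rw [volume_film_const, ← ENNReal.ofReal_mul P.ell_pos.le, mul_div_cancel₀ _ P.ell_pos.ne']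
  refine ⟨c.raise t P.flatStrain, ⟨hadm.raise P ht0 (flatStrain_apply_zero P), ?_⟩, ?_⟩
  · rw [Config.raise, volume_film_raise hadm.profile.nonneg ht0, hstrip,
      ← ofReal_measureReal hfin, ← hv, ← ENNReal.ofReal_add hvd measureReal_nonneg, sub_add_cancel]
  · rw [energy_raise P hadm.profile ht0, elasticDensity_flatStrain, hstrip, penalizedEnergy,
      ← ENNReal.ofReal_mul' hvd]
    gcongr

end Configurations

end EpitaxialFilm

end

theorem mainTheorem11 (P : EpitaxialFilm.FilmData) {k : ℕ} (b : Fin k → EpitaxialFilm.Plane)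
    (d : ℝ) (hd : 0 < d) (c : EpitaxialFilm.Config)
    (hc : EpitaxialFilm.IsMinimizer (EpitaxialFilm.classEq P b d) (EpitaxialFilm.energy P) c)
    (Λ : ℝ) (hΛ : P.e0 ^ 2 * P.W0 < Λ) :
    EpitaxialFilm.IsMinimizer (EpitaxialFilm.classLe P b d)
      (EpitaxialFilm.penalizedEnergy P Λ d) c := by
  refine ⟨⟨hc.1.1, hc.1.2.le⟩, fun c' hc' => ?_⟩
  obtain ⟨c₁, hc₁, hle⟩ :=
    EpitaxialFilm.exists_mem_classEq_energy_le_penalizedEnergy P hd.le hΛ.le hc'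
  calc EpitaxialFilm.penalizedEnergy P Λ d c
      = EpitaxialFilm.energy P c := EpitaxialFilm.penalizedEnergy_eq_energy P hd.le Λ hc.1
    _ ≤ EpitaxialFilm.energy P c₁ := hc.2 c₁ hc₁
    _ ≤ EpitaxialFilm.penalizedEnergy P Λ d c' := hle
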